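/- Consider the cognitive multi-antenna wiretap channel with artificial noise. Let $K$ be a finite non-empty set (the eavesdroppers), and let $H_0\in\mathbb C^{b\times n}$, $H_k\in\mathbb C^{e_k\times n}$ $(k\in K)$, $G\in\mathbb C^{p\times n}$ and $V\in\mathbb C^{n\times m}$ be complex matrices; in the application $V$ is the projection matrix on the null space of $H_0$ (so $m=n$), but $V$ may be arbitrary. Put $P_k=H_kV$, and let $\Gamma>0$ and $P>0$. For $Z=(Q,W)$ with $Q\in\mathbb C^{n\times n}$ and $W\in\mathbb C^{m\times m}$ Hermitian let $$C_0(Q)=\log|I+H_0QH_0^H|,\quad \varphi_k(Z)=\log|I+H_kQH_k^H+P_kWP_k^H|,\quad \phi_k(W)=\log|I+P_kWP_k^H|,$$ $$C_k(Z)=\varphi_k(Z)-\phi_k(W),\qquad C_s(Z)=C_0(Q)-\max_{k\in K}C_k(Z),$$ $$S_Z=\{Z:\ P_I(Z)\le\Gamma,\ \operatorname{tr}Q+\operatorname{tr}W\le P,\ Q\succeq0,\ W\succeq0\},\quad P_I(Z)=\operatorname{tr}(GQG^H+GVWV^HG^H).$$ Problem (P1) is to maximize $C_s(Z)$ over $Z\in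 S_Z$. Problem (P2a) is to maximize $t_2$ over $(Z,t_2)$ subject to $Z\in S_Z$ and $t_2-C_0(Q)+C_k(Z)\le0$ for all $k\in K$. For an expansion point $\tilde Z=(\tilde Q,\tilde W)$ let $$C_{lk}(Z|\tilde Z)=\varphi_k(\tilde Z)+\operatorname{tr}\big(T_k(\tilde Z)(Q-\tilde Q)\big)+\operatorname{tr}\big(R_k(\tilde Z)(W-\tilde W)\big)-\phi_k(W),$$ where, with $\Sigma_k=I+H_k\tilde QH_k^H+P_k\tilde WP_k^H$, $T_k(\tilde Z)=H_k^H\Sigma_k^{-1}H_k$ and $R_k(\tilde Z)=P_k^H\Sigma_k^{-1}P_k$. Let the sequence $(Z^v,t^v)$ be generated by the iteration (P3a): for every $v\ge0$, $(Z^{v+1},t^{v+1})$ is a maximizer of $C_0(Q)-t$ over all $(Z,t)$ with $Z\in S_Z$ and $C_{lk}(Z|Z^v)\le t$ for all $k\in K$. Proposition. Let $Z_c=(Q_c,W_c)$ be a convergence point of (P3a), that is, $Z_c=Z^v=Z^{v-1}$ for some $v\ge1$. Then $Z_c$, together with $t_2=C_0(Q_c)-t^v$, is a KKT point of (P2a):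 there are $\mu_1,\mu_2\ge0$, $\lambda_k\ge0$ $(k\in K)$ and Hermitian matrices $M,N\succeq0$ such that the Lagrangian $$L=-t_2+\mu_1(P_I(Z)-\Gamma)+\mu_2(\operatorname{tr}Q+\operatorname{tr}W-P)-\operatorname{tr}(MQ)-\operatorname{tr}(NW)+\sum_{k\in K}\lambda_k\big(t_2+C_k(Z)-C_0(Q)\big)$$ satisfies $\nabla_QL=0$, $\nabla_WL=0$, $\partial L/\partial t_2=0$ at $(Z_c,t_2)$ (gradients on the real spaces of Hermitian matrices), the complementary slackness conditions $\mu_1(P_I(Z_c)-\Gamma)=0$, $\mu_2(\operatorname{tr}Q_c+\operatorname{tr}W_c-P)=0$, $MQ_c=0$, $NW_c=0$, $\lambda_k(t_2+C_k(Z_c)-C_0(Q_c))=0$ for all $k$ hold, and $(Z_c,t_2)$ is feasible for (P2a). Consequently $Z_c$ is a stationary point of (P1): $Z_c\in S_Z$, and for every $Z'\in S_Z$ the one-sided directional derivative of $C_s$ at $Z_c$ in the direction $Z'-Z_c$ exists and is at most $0$. -/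

import Mathlib

open scoped Matrix ComplexOrder

/-- Data of the cognitive multi-antenna wiretap channel with artificial noise.
`n` transmit antennas, artificial noise of dimension `m`, `b` antennas at the legitimate receiver,
`p` at the primary user, and `e k` at the eavesdropper `k`.
`V` is the matrix through which the artificial noise is sent. In applications it is the projection
matrix on the null space of `H0` (then `m = n`), or a matrix whose columns form an orthonormal basis
of that null space; nothing is required of it here. -/
structure WiretapChannel (n m b p : ℕ) {κ : Type*} (e : κ → ℕ) where
  /-- channel to the legitimate receiver -/
  H0 : Matrix (Fin b) (Fin n) ℂ
  /-- channels to the eavesdroppers -/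
  H : (k : κ) → Matrix (Fin (e k)) (Fin n) ℂ
  /-- channel to the primary user -/
  G : Matrix (Fin p) (Fin n) ℂ
  /-- artificial noise precoder (projection on the null space of `H0`) -/
  V : Matrix (Fin n) (Fin m) ℂ
  /-- bound on the interference power at the primary user -/
  interf : ℝ
  /-- bound on the total transmit power -/
  power : ℝ

/-- The aggregate variable `Z = (Q, W)`: signal and artificial noise covariance matrices. -/
abbrev CovPair (n m : ℕ) : Type :=
  Matrix (Fin n) (Fin n) ℂ × Matrix (Fin m) (Fin m) ℂ

/-- `log |A|`. It is applied to Hermitian positive definite matrices, whose determinant is a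
positive real number. -/
noncomputable def logDet {d : ℕ} (A : Matrix (Fin d) (Fin d) ℂ) : ℝ :=
  Real.log A.det.re

/-- `A` is the gradient at `X` of a real function `f` of a Hermitian matrix variable, for the inner
product `⟨A, D⟩ = Re tr (A D)` of the real vector space of Hermitian matrices. -/
def HasHermGradient {d : ℕ} (f : Matrix (Fin d) (Fin d) ℂ → ℝ)
    (X A : Matrix (Fin d) (Fin d) ℂ) : Prop :=
  A.IsHermitian ∧ ∀ D : Matrix (Fin d) (Fin d) ℂ, D.IsHermitian →
    HasDerivAt (fun s : ℝ => f (X + s • D)) (A * D).trace.re 0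

namespace WiretapChannel

variable {n m b p : ℕ} {κ : Type*} {e : κ → ℕ} (S : WiretapChannel n m b p e)

/-- The projected channel `P_k = H_k V` of the eavesdropper `k`. -/
def projH (k : κ) : Matrix (Fin (e k)) (Fin m) ℂ := S.H k * S.V

/-- Rate of the legitimate link, `C_0(Q) = log |I + H_0 Q H_0ᴴ|`. -/
noncomputable def rate0 (Q : Matrix (Fin n) (Fin n) ℂ) : ℝ :=
  logDet (1 + S.H0 * Q * S.H0ᴴ)

/-- `I + H_k Q H_kᴴ + P_k W P_kᴴ`. -/
def eveCov (k : κ) (Z : CovPair n m) : Matrix (Fin (e k)) (Fin (e k)) ℂ :=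
  1 + S.H k * Z.1 * (S.H k)ᴴ + S.projH k * Z.2 * (S.projH k)ᴴ

/-- `φ_k(W) = log |I + P_k W P_kᴴ|`. -/
noncomputable def phi (k : κ) (W : Matrix (Fin m) (Fin m) ℂ) : ℝ :=
  logDet (1 + S.projH k * W * (S.projH k)ᴴ)

/-- `ϕ_k(Z) = log |I + H_k Q H_kᴴ + P_k W P_kᴴ|`. -/
noncomputable def varphi (k : κ) (Z : CovPair n m) : ℝ := logDet (S.eveCov k Z)

/-- Rate of the eavesdropper `k`, `C_k(Z) = ϕ_k(Z) - φ_k(W)`. -/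
noncomputable def rateEve (k : κ) (Z : CovPair n m) : ℝ := S.varphi k Z - S.phi k Z.2

/-- Secrecy rate `C_s(Z) = C_0(Q) - max_k C_k(Z)`. -/
noncomputable def secrecyRate [Fintype κ] [Nonempty κ] (Z : CovPair n m) : ℝ :=
  S.rate0 Z.1 - Finset.univ.sup' Finset.univ_nonempty (fun k => S.rateEve k Z)

/-- Interference power `P_I(Z) = tr (G Q Gᴴ + G V W Vᴴ Gᴴ)`. -/
noncomputable def interference (Z : CovPair n m) : ℝ :=
  (S.G * Z.1 * S.Gᴴ + S.G * S.V * Z.2 * S.Vᴴ * S.Gᴴ).trace.re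

/-- Transmit power `tr Q + tr W`. -/
noncomputable def transmitPower (Z : CovPair n m) : ℝ := (Z.1.trace + Z.2.trace).re

/-- The feasible set `S_Z` of problem (P1), the maximization of `C_s` over `S_Z`. -/
def feasible : Set (CovPair n m) :=
  {Z | S.interference Z ≤ S.interf ∧ transmitPower Z ≤ S.power ∧
    Z.1.PosSemidef ∧ Z.2.PosSemidef}

/-- `T_k(Z) = H_kᴴ (I + H_k Q H_kᴴ + P_k W P_kᴴ)⁻¹ H_k`. -/
noncomputable def gradT (k : κ) (Z : CovPair n m) : Matrix (Fin n) (Fin n) ℂ :=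
  (S.H k)ᴴ * (S.eveCov k Z)⁻¹ * S.H k

/-- `R_k(Z) = P_kᴴ (I + H_k Q H_kᴴ + P_k W P_kᴴ)⁻¹ P_k`. -/
noncomputable def gradR (k : κ) (Z : CovPair n m) : Matrix (Fin m) (Fin m) ℂ :=
  (S.projH k)ᴴ * (S.eveCov k Z)⁻¹ * S.projH k

/-- The linear approximation of `ϕ_k` around `Z₀`, evaluated at `Z`. -/
noncomputable def varphiLin (k : κ) (Z₀ Z : CovPair n m) : ℝ :=
  S.varphi k Z₀ + (S.gradT k Z₀ * (Z.1 - Z₀.1)).trace.re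
    + (S.gradR k Z₀ * (Z.2 - Z₀.2)).trace.re

/-- The convex approximation `C_{lk}(Z | Z₀)` of `C_k` at `Z₀`, evaluated at `Z`. -/
noncomputable def rateEveApprox (k : κ) (Z₀ Z : CovPair n m) : ℝ :=
  S.varphiLin k Z₀ Z - S.phi k Z.2

/-- The feasible set `S_{Z,t}(Z₀)` of the convex approximation at the expansion point `Z₀`. -/
def approxFeasible (Z₀ : CovPair n m) : Set (CovPair n m × ℝ) :=
  {x | x.1 ∈ S.feasible ∧ ∀ k, S.rateEveApprox k Z₀ x.1 ≤ x.2}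

/-- The objective `R(Q, t) = C_0(Q) - t`. -/
noncomputable def approxObjective (x : CovPair n m × ℝ) : ℝ := S.rate0 x.1.1 - x.2

/-- The iteration (P3a): `(Z (v+1), t (v+1))` is a maximizer of `R` over `S_{Z,t}(Z v)`. -/
def IsSCAIteration (Z : ℕ → CovPair n m) (t : ℕ → ℝ) : Prop :=
  ∀ v : ℕ, (Z (v + 1), t (v + 1)) ∈ S.approxFeasible (Z v) ∧
    IsMaxOn S.approxObjective (S.approxFeasible (Z v)) (Z (v + 1), t (v + 1))

/-- The Lagrangian of problem (P2a): maximize `t₂` subject to `t₂ - C_0(Q) + C_k(Z) ≤ 0` for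
all `k` and `Z ∈ S_Z`. -/
noncomputable def lagrangian [Fintype κ] (μ₁ μ₂ : ℝ) (lam : κ → ℝ)
    (M : Matrix (Fin n) (Fin n) ℂ) (N : Matrix (Fin m) (Fin m) ℂ)
    (Q : Matrix (Fin n) (Fin n) ℂ) (W : Matrix (Fin m) (Fin m) ℂ) (t₂ : ℝ) : ℝ :=
  -t₂ + μ₁ * (S.interference (Q, W) - S.interf) + μ₂ * (transmitPower (Q, W) - S.power)
    - ((M * Q).trace + (N * W).trace).re
    + ∑ k, lam k * (t₂ + S.rateEve k (Q, W) - S.rate0 Q)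

/-- `(Z, t₂)` is a KKT point of problem (P2a): there are multipliers with which it satisfies
stationarity of the Lagrangian in each of the variables `Q`, `W`, `t₂`, complementary slackness,
and dual and primal feasibility. -/
def IsKKTPoint [Fintype κ] (Z : CovPair n m) (t₂ : ℝ) : Prop :=
  ∃ (μ₁ μ₂ : ℝ) (lam : κ → ℝ)
    (M : Matrix (Fin n) (Fin n) ℂ) (N : Matrix (Fin m) (Fin m) ℂ),
    -- stationarity
    HasHermGradient (fun Q => S.lagrangian μ₁ μ₂ lam M N Q Z.2 t₂) Z.1 0 ∧
    HasHermGradient (fun W => S.lagrangian μ₁ μ₂ lam M N Z.1 W t₂) Z.2 0 ∧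
    HasDerivAt (fun t => S.lagrangian μ₁ μ₂ lam M N Z.1 Z.2 t) 0 t₂ ∧
    -- complementary slackness
    μ₁ * (S.interference Z - S.interf) = 0 ∧
    μ₂ * (transmitPower Z - S.power) = 0 ∧
    M * Z.1 = 0 ∧ N * Z.2 = 0 ∧
    (∀ k, lam k * (t₂ + S.rateEve k Z - S.rate0 Z.1) = 0) ∧
    -- dual feasibility
    0 ≤ μ₁ ∧ 0 ≤ μ₂ ∧ (∀ k, 0 ≤ lam k) ∧ M.PosSemidef ∧ N.PosSemidef ∧
    -- primal feasibility
    Z ∈ S.feasible ∧ ∀ k, t₂ - S.rate0 Z.1 + S.rateEve k Z ≤ 0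

/-- `Z` is a (first-order) stationary point of problem (P1): it is feasible, and at `Z` the
one-sided directional derivative of the secrecy rate (a minimum of finitely many smooth functions)
towards any other feasible point exists and is nonpositive. The feasible set is convex. -/
def IsStationaryPoint [Fintype κ] [Nonempty κ] (Z : CovPair n m) : Prop :=
  Z ∈ S.feasible ∧ ∀ Z' ∈ S.feasible, ∃ d : ℝ, d ≤ 0 ∧
    HasDerivWithinAt (fun s : ℝ => S.secrecyRate (Z + s • (Z' - Z))) d (Set.Ici 0) 0

end WiretapChannel

open Filter Topology

/-! At a convergence point, `Zc` solves a subproblem expanded at `Zc` itself. There the surrogate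
`rateEveApprox` agrees with `rateEve` in value and in first derivative, so optimality passes to
first order from the surrogate to the true problem: along any feasible direction some active
eavesdropper has nonpositive derivative of its margin `C_0 - C_k` (`exists_marginDiff_nonpos`). Only
convexity of the feasible set enters, not concavity of the rates.

Stationarity for (P1) follows because `C_s` is the minimum of the margins and touches each active
one at `Zc`. For KKT, the same fact says that finitely many affine functions are never
simultaneously positive on the cone of positive semidefinite pairs. Separation gives nonnegative
weights (`exists_multipliers`); the point 0, strictly feasible since both bounds are positive,
excludes zero total weight on the eavesdroppers. `M` and `N` are then defined by stationarity, and
self-duality of the cone gives their positivity and slackness. -/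

/-! ### Theorem of the alternative for affine functions on a convex set. -/

/-- The convex image of `C` misses the open positive orthant; the weights are minus the coefficients
of a separating functional. -/
theorem exists_nonneg_weights_of_no_common_pos {E ι : Type*} [AddCommGroup E] [Module ℝ E]
    [Fintype ι] {C : Set E} (hC : Convex ℝ C) (L : ι → E →ₗ[ℝ] ℝ) (c : ι → ℝ)
    (h : ∀ x ∈ C, ∃ i, L i x + c i ≤ 0) (hne : C.Nonempty) :
    ∃ w : ι → ℝ, (∀ i, 0 ≤ w i) ∧ (∃ i, w i ≠ 0) ∧ ∀ x ∈ C, ∑ i, w i * (L i x + c i) ≤ 0 := by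
  classical
  set O : Set (ι → ℝ) := Set.univ.pi fun _ => Set.Ioi 0 with hO
  set F : E → ι → ℝ := fun x i => L i x + c i
  have hOo : IsOpen O := isOpen_set_pi Set.finite_univ fun _ _ => isOpen_Ioi
  have hOc : Convex ℝ O := convex_pi fun _ _ => convex_Ioi 0
  have hFc : Convex ℝ (F '' C) := by
    rintro _ ⟨x, hx, rfl⟩ _ ⟨y, hy, rfl⟩ a b ha hb hab
    refine ⟨a • x + b • y, hC hx hy ha hb hab, ?_⟩
    ext i
    simp only [F, map_add, map_smul, Pi.add_apply, Pi.smul_apply, smul_eq_mul]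
    linear_combination (-c i) * hab
  have hdisj : Disjoint O (F '' C) := by
    rw [Set.disjoint_left]
    rintro _ hp ⟨x, hx, rfl⟩
    obtain ⟨i, hi⟩ := h x hx
    exact absurd (hp i (Set.mem_univ i)) (not_lt.2 hi)
  obtain ⟨f, u, hf, hu⟩ := geometric_hahn_banach_open hOc hOo hFc hdisj
  have hsum : ∀ y : ι → ℝ, f y = ∑ i, y i * f (Pi.single i 1) := by
    intro y
    conv_lhs => rw [pi_eq_sum_univ' y]
    simp [map_sum]
  have hlim : ∀ y : ι → ℝ, (∀ i, 0 ≤ y i) → f y ≤ 0 ∧ f y ≤ u := by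
    intro y hy
    -- The orthant is open, so `y` on its boundary is approached by adding `a` times the all-ones
    -- vector. Letting `a → 0` and then scaling by `r` forces `f y ≤ 0`.
    have key : ∀ r : ℝ, 0 < r → ∀ a : ℝ, 0 < a → f (r • y) + a * f (fun _ => 1) < u := by
      intro r hr a ha
      have := hf (r • y + a • (fun _ => 1)) (by
        intro i _
        have := mul_nonneg hr.le (hy i)
        simp only [Pi.add_apply, Pi.smul_apply, smul_eq_mul, mul_one, Set.mem_Ioi]
        linarith)
      simpa using this
    have key2 : ∀ r : ℝ, 0 < r → r * f y ≤ u := by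
      intro r hr
      have ht : Tendsto (fun a : ℝ => f (r • y) + a * f (fun _ => 1)) (𝓝[>] 0)
          (𝓝 (f (r • y) + 0 * f (fun _ => 1))) :=
        ((by fun_prop : Continuous fun a : ℝ => f (r • y) + a * f (fun _ => 1)).tendsto 0).mono_left
          nhdsWithin_le_nhds
      have := le_of_tendsto ht (eventually_mem_nhdsWithin.mono fun a ha => (key r hr a ha).le)
      simpa using this
    refine ⟨?_, by simpa using key2 1 one_pos⟩
    by_contra! hpos
    have h1 := key2 ((|u| + 1) / f y) (by positivity)
    rw [div_mul_cancel₀ _ hpos.ne'] at h1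
    linarith [le_abs_self u]
  have hu0 : 0 ≤ u := by simpa using (hlim 0 (fun _ => le_rfl)).2
  refine ⟨fun i => - f (Pi.single i 1), fun i => ?_, ?_, fun x hx => ?_⟩
  · have := (hlim (Pi.single i 1) (fun j => by
      by_cases hj : j = i
      · subst hj; simp
      · simp [hj])).1
    simpa using this
  -- If `f = 0`, the strict side of the separation gives `0 < u` and the other side `u ≤ 0`.
  · by_contra! hz
    have hf0 : ∀ y, f y = 0 := fun y => by
      rw [hsum]
      exact Finset.sum_eq_zero fun i _ => by rw [neg_eq_zero.1 (hz i), mul_zero]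
    obtain ⟨x, hx⟩ := hne
    have h1 := hf (fun _ => 1) (fun i _ => by simp)
    have h2 := hu (F x) ⟨x, hx, rfl⟩
    rw [hf0] at h1 h2
    linarith
  · have h2 := hu (F x) ⟨x, hx, rfl⟩
    rw [hsum] at h2
    have : ∑ i, -f (Pi.single i 1) * (L i x + c i) = -∑ i, F x i * f (Pi.single i 1) := by
      rw [← Finset.sum_neg_distrib]
      exact Finset.sum_congr rfl fun i _ => by simp only [F]; ring
    rw [this]
    linarith

/-! ### One-sided derivatives of finite maxima. -/

theorem HasDerivWithinAt.le_of_le_of_eq {f g : ℝ → ℝ} {f' g' a : ℝ}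
    (hf : HasDerivWithinAt f f' (Set.Ici a) a) (hg : HasDerivWithinAt g g' (Set.Ici a) a)
    (hle : ∀ x, f x ≤ g x) (heq : f a = g a) : f' ≤ g' := by
  rw [hasDerivWithinAt_iff_tendsto_slope, Set.Ici_sdiff_left] at hf hg
  refine le_of_tendsto_of_tendsto hf hg (eventually_mem_nhdsWithin.mono fun x hx => ?_)
  have hx' : 0 < x - a := sub_pos.2 hx
  simp only [slope_def_field, heq]
  have := hle x
  gcongr

theorem HasDerivWithinAt.exists_max {f g : ℝ → ℝ} {f' g' a : ℝ}
    (hf : HasDerivWithinAt f f' (Set.Ici a) a) (hg : HasDerivWithinAt g g' (Set.Ici a) a) :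
    ∃ d, HasDerivWithinAt (fun x => max (f x) (g x)) d (Set.Ici a) a := by
  rcases lt_trichotomy (f a) (g a) with h | h | h
  · refine ⟨g', hg.congr_of_eventuallyEq ?_ (max_eq_right h.le)⟩
    filter_upwards [hf.continuousWithinAt.tendsto.eventually_lt hg.continuousWithinAt.tendsto h]
      with x hx using max_eq_right hx.le
  -- At a tie, the slope of the maximum is the maximum of the slopes, because the increment `x - a`
  -- is positive.
  · refine ⟨max f' g', ?_⟩
    rw [hasDerivWithinAt_iff_tendsto_slope, Set.Ici_sdiff_left] at hf hg ⊢
    refine (hf.max hg).congr' (eventually_mem_nhdsWithin.mono fun x hx => ?_)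
    have hx' : 0 < x - a := sub_pos.2 hx
    simp only [slope_def_field, h, max_self]
    rw [max_div_div_right hx'.le, max_sub_sub_right]
  · refine ⟨f', hf.congr_of_eventuallyEq ?_ (max_eq_left h.le)⟩
    filter_upwards [hg.continuousWithinAt.tendsto.eventually_lt hf.continuousWithinAt.tendsto h]
      with x hx using max_eq_left hx.le

theorem HasDerivWithinAt.exists_finset_sup' {κ : Type*} {f : κ → ℝ → ℝ} {f' : κ → ℝ} {a : ℝ}
    (hf : ∀ k, HasDerivWithinAt (f k) (f' k) (Set.Ici a) a) (s : Finset κ) (hs : s.Nonempty) :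
    ∃ d, HasDerivWithinAt (fun x => s.sup' hs fun k => f k x) d (Set.Ici a) a := by
  induction hs using Finset.Nonempty.cons_induction with
  | singleton k => exact ⟨f' k, by simpa using hf k⟩
  | cons k s hk hs ih =>
    obtain ⟨d, hd⟩ := ih
    obtain ⟨d', hd'⟩ := (hf k).exists_max hd
    exact ⟨d', hd'.congr_of_mem (fun x _ => by rw [Finset.sup'_cons hs]) (by simp)⟩

/-! ### Derivative of the log-determinant. -/

theorem Matrix.hasDerivAt_det_add_smul {d : ℕ} {A : Matrix (Fin d) (Fin d) ℂ} (hA : IsUnit A.det)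
    (B : Matrix (Fin d) (Fin d) ℂ) :
    HasDerivAt (fun s : ℝ => (A + s • B).det) (A.det * (A⁻¹ * B).trace) 0 := by
  set q := (Matrix.det (1 + (Polynomial.X : Polynomial ℂ) •
    (A⁻¹ * B).map Polynomial.C)).divX.divX with hq
  -- Factoring out `A` leaves `det (1 + s A⁻¹B)`, a polynomial in `s` with linear coefficient the
  -- trace; `q` collects the terms of order at least two.
  have hfac : ∀ s : ℝ, (A + s • B).det =
      A.det * (1 + (A⁻¹ * B).trace * (s : ℂ) + q.eval (s : ℂ) * (s : ℂ) ^ 2) := by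
    intro s
    rw [hq, ← Matrix.det_one_add_smul, ← Matrix.det_mul, mul_add, mul_one, mul_smul_comm,
      ← mul_assoc, Matrix.mul_nonsing_inv A hA, one_mul]
    rfl
  have h1 : HasDerivAt (fun z : ℂ => A.det * (1 + (A⁻¹ * B).trace * z + q.eval z * z ^ 2))
      (A.det * (A⁻¹ * B).trace) ((0 : ℝ) : ℂ) := by
    have := ((((hasDerivAt_id (0 : ℂ)).const_mul (A⁻¹ * B).trace).const_add 1).add
      ((q.hasDerivAt 0).mul ((hasDerivAt_id (0 : ℂ)).pow 2))).const_mul A.det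
    simpa using this
  rw [funext hfac]
  exact h1.comp_ofReal

theorem hasDerivAt_logDet {d : ℕ} {A : Matrix (Fin d) (Fin d) ℂ} (hA : A.PosDef)
    (B : Matrix (Fin d) (Fin d) ℂ) :
    HasDerivAt (fun s : ℝ => logDet (A + s • B)) (A⁻¹ * B).trace.re 0 := by
  obtain ⟨hre, him⟩ := Complex.pos_iff.1 hA.det_pos
  have h := Complex.reCLM.hasFDerivAt.comp_hasDerivAt (0 : ℝ)
    (Matrix.hasDerivAt_det_add_smul hA.det_pos.ne'.isUnit B)
  have h2 := h.log (by simpa using hre.ne')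
  refine h2.congr_deriv ?_
  simp [Complex.mul_re, ← him, hre.ne']

/-! ### The positive semidefinite cone under the trace pairing. -/

open scoped MatrixOrder in
theorem Matrix.PosSemidef.mul_eq_zero_of_trace_re_eq_zero {d : ℕ}
    {M Q : Matrix (Fin d) (Fin d) ℂ} (hM : M.PosSemidef) (hQ : Q.PosSemidef)
    (h : (M * Q).trace.re = 0) : M * Q = 0 := by
  obtain ⟨B, rfl⟩ := CStarAlgebra.nonneg_iff_eq_star_mul_self.mp hM.nonneg
  obtain ⟨C, rfl⟩ := CStarAlgebra.nonneg_iff_eq_star_mul_self.mp hQ.nonneg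
  simp only [Matrix.star_eq_conjTranspose] at h ⊢
  -- With `M = BᴴB` and `Q = CᴴC`, the trace is the squared Frobenius norm of `B Cᴴ`.
  have htr : (Bᴴ * B * (Cᴴ * C)).trace = ((B * Cᴴ)ᴴ * (B * Cᴴ)).trace := by
    rw [← Matrix.mul_assoc, Matrix.trace_mul_comm]
    simp only [Matrix.conjTranspose_mul, Matrix.conjTranspose_conjTranspose, Matrix.mul_assoc]
  have hpos := (Matrix.posSemidef_conjTranspose_mul_self (B * Cᴴ)).trace_nonneg
  rw [htr] at h
  have h0 : ((B * Cᴴ)ᴴ * (B * Cᴴ)).trace = 0 :=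
    Complex.ext h (Complex.nonneg_iff.1 hpos).2.symm
  have hBC := Matrix.trace_conjTranspose_mul_self_eq_zero_iff.1 h0
  rw [Matrix.mul_assoc, ← Matrix.mul_assoc B, hBC, Matrix.zero_mul, Matrix.mul_zero]

/-- Self-duality of the cone: testing against the rank-one matrices `x xᴴ` recovers the quadratic
form. -/
theorem Matrix.IsHermitian.posSemidef_of_trace_mul_re_nonneg {d : ℕ}
    {M : Matrix (Fin d) (Fin d) ℂ} (hM : M.IsHermitian)
    (h : ∀ Q : Matrix (Fin d) (Fin d) ℂ, Q.PosSemidef → 0 ≤ (M * Q).trace.re) :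
    M.PosSemidef := by
  refine .of_dotProduct_mulVec_nonneg hM fun x => ?_
  have h1 := h _ (Matrix.posSemidef_vecMulVec_self_star x)
  rw [Matrix.mul_vecMulVec, Matrix.trace_vecMulVec, dotProduct_comm] at h1
  rw [Complex.nonneg_iff]
  exact ⟨h1, (hM.im_star_dotProduct_mulVec_self x).symm⟩

/-- The real linear functional `(Q, W) ↦ Re tr (A Q) + Re tr (B W)`. -/
noncomputable def tracePairing {n m : ℕ} (A : Matrix (Fin n) (Fin n) ℂ)
    (B : Matrix (Fin m) (Fin m) ℂ) : CovPair n m →ₗ[ℝ] ℝ where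
  toFun Z := (A * Z.1).trace.re + (B * Z.2).trace.re
  map_add' X Y := by
    simp only [Prod.fst_add, Prod.snd_add, Matrix.mul_add, Matrix.trace_add, Complex.add_re]
    ring
  map_smul' r X := by
    simp [Matrix.trace_smul, mul_add]

theorem tracePairing_apply {n m : ℕ} (A : Matrix (Fin n) (Fin n) ℂ)
    (B : Matrix (Fin m) (Fin m) ℂ) (Z : CovPair n m) :
    tracePairing A B Z = (A * Z.1).trace.re + (B * Z.2).trace.re := rfl

theorem hasDerivAt_linearMap_line {E : Type*} [AddCommGroup E] [Module ℝ E] (L : E →ₗ[ℝ] ℝ)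
    (X D : E) : HasDerivAt (fun s : ℝ => L (X + s • D)) (L D) 0 := by
  simp only [map_add, map_smul, smul_eq_mul]
  simpa using ((hasDerivAt_id (0 : ℝ)).mul_const (L D)).const_add (L X)

theorem posDef_one_add_mul_mul_conjTranspose {r d : ℕ} (F : Matrix (Fin r) (Fin d) ℂ)
    {X : Matrix (Fin d) (Fin d) ℂ} (hX : X.PosSemidef) : (1 + F * X * Fᴴ).PosDef :=
  Matrix.PosDef.one.add_posSemidef (hX.mul_mul_conjTranspose_same F)

theorem trace_mul_sandwich {r d : ℕ} (F : Matrix (Fin r) (Fin d) ℂ)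
    (A : Matrix (Fin r) (Fin r) ℂ) (D : Matrix (Fin d) (Fin d) ℂ) :
    (A * (F * D * Fᴴ)).trace = (Fᴴ * A * F * D).trace := by
  rw [← Matrix.mul_assoc, Matrix.trace_mul_comm]
  simp only [Matrix.mul_assoc]

/-! ### Differentials of the rates and convexity of the feasible set. -/

namespace WiretapChannel

variable {n m b p : ℕ} {κ : Type*} {e : κ → ℕ} (S : WiretapChannel n m b p e)

/-- The gradient of `C_0` at `Q`. -/
noncomputable def gradRate0 (Q : Matrix (Fin n) (Fin n) ℂ) : Matrix (Fin n) (Fin n) ℂ :=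
  S.H0ᴴ * (1 + S.H0 * Q * S.H0ᴴ)⁻¹ * S.H0

/-- The gradient of `φ_k` at `W`. -/
noncomputable def gradPhi (k : κ) (W : Matrix (Fin m) (Fin m) ℂ) : Matrix (Fin m) (Fin m) ℂ :=
  (S.projH k)ᴴ * (1 + S.projH k * W * (S.projH k)ᴴ)⁻¹ * S.projH k

/-- The differential of `C_0 - C_k` at `Z`. -/
noncomputable def marginDiff (k : κ) (Z : CovPair n m) : CovPair n m →ₗ[ℝ] ℝ :=
  tracePairing (S.gradRate0 Z.1 - S.gradT k Z) (S.gradPhi k Z.2 - S.gradR k Z)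

theorem posDef_eveCov (k : κ) {Z : CovPair n m} (h1 : Z.1.PosSemidef) (h2 : Z.2.PosSemidef) :
    (S.eveCov k Z).PosDef :=
  (posDef_one_add_mul_mul_conjTranspose _ h1).add_posSemidef (h2.mul_mul_conjTranspose_same _)

theorem hasDerivAt_rate0 {Q : Matrix (Fin n) (Fin n) ℂ} (hQ : Q.PosSemidef)
    (D : Matrix (Fin n) (Fin n) ℂ) :
    HasDerivAt (fun s : ℝ => S.rate0 (Q + s • D)) (S.gradRate0 Q * D).trace.re 0 := by
  have h := hasDerivAt_logDet (posDef_one_add_mul_mul_conjTranspose S.H0 hQ) (S.H0 * D * S.H0ᴴ)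
  rw [trace_mul_sandwich] at h
  refine h.congr_of_eventuallyEq (.of_forall fun s => ?_)
  simp only [rate0, Matrix.mul_add, Matrix.add_mul, Matrix.mul_smul, Matrix.smul_mul, add_assoc]

theorem hasDerivAt_phi (k : κ) {W : Matrix (Fin m) (Fin m) ℂ} (hW : W.PosSemidef)
    (D : Matrix (Fin m) (Fin m) ℂ) :
    HasDerivAt (fun s : ℝ => S.phi k (W + s • D)) (S.gradPhi k W * D).trace.re 0 := by
  have h := hasDerivAt_logDet (posDef_one_add_mul_mul_conjTranspose (S.projH k) hW)
    (S.projH k * D * (S.projH k)ᴴ)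
  rw [trace_mul_sandwich] at h
  refine h.congr_of_eventuallyEq (.of_forall fun s => ?_)
  simp only [phi, Matrix.mul_add, Matrix.add_mul, Matrix.mul_smul, Matrix.smul_mul, add_assoc]

theorem hasDerivAt_varphi (k : κ) {Z : CovPair n m} (h1 : Z.1.PosSemidef) (h2 : Z.2.PosSemidef)
    (D : CovPair n m) :
    HasDerivAt (fun s : ℝ => S.varphi k (Z + s • D))
      (tracePairing (S.gradT k Z) (S.gradR k Z) D) 0 := by
  have h := hasDerivAt_logDet (S.posDef_eveCov k h1 h2)
    (S.H k * D.1 * (S.H k)ᴴ + S.projH k * D.2 * (S.projH k)ᴴ)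
  rw [Matrix.mul_add, Matrix.trace_add, trace_mul_sandwich, trace_mul_sandwich,
    Complex.add_re] at h
  refine h.congr_of_eventuallyEq (.of_forall fun s => ?_)
  simp only [varphi, eveCov, Prod.fst_add, Prod.snd_add, Prod.smul_fst, Prod.smul_snd,
    Matrix.mul_add, Matrix.add_mul, Matrix.mul_smul, Matrix.smul_mul, smul_add]
  congr 1
  abel

theorem varphiLin_eq (k : κ) (Z₀ Z : CovPair n m) :
    S.varphiLin k Z₀ Z = S.varphi k Z₀ + tracePairing (S.gradT k Z₀) (S.gradR k Z₀) (Z - Z₀) := by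
  rw [varphiLin, tracePairing_apply, add_assoc]
  rfl

theorem rateEveApprox_self (k : κ) (Z : CovPair n m) :
    S.rateEveApprox k Z Z = S.rateEve k Z := by
  simp [rateEveApprox, varphiLin_eq, rateEve]

theorem marginDiff_apply (k : κ) (Z D : CovPair n m) :
    S.marginDiff k Z D = (S.gradRate0 Z.1 * D.1).trace.re
      - (tracePairing (S.gradT k Z) (S.gradR k Z) D - (S.gradPhi k Z.2 * D.2).trace.re) := by
  simp only [marginDiff, tracePairing_apply, Matrix.sub_mul, Matrix.trace_sub, Complex.sub_re]
  ring

theorem hasDerivAt_margin (k : κ) {Z : CovPair n m} (h1 : Z.1.PosSemidef) (h2 : Z.2.PosSemidef)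
    (D : CovPair n m) :
    HasDerivAt (fun s : ℝ => S.rate0 (Z + s • D).1 - S.rateEve k (Z + s • D))
      (S.marginDiff k Z D) 0 := by
  rw [marginDiff_apply]
  exact (S.hasDerivAt_rate0 h1 D.1).sub
    ((S.hasDerivAt_varphi k h1 h2 D).sub (S.hasDerivAt_phi k h2 D.2))

/-- The surrogate is tangent at its expansion point: only `varphi` is linearized, so this derivative
is that of the true margin. -/
theorem hasDerivAt_approxMargin (k : κ) {Z : CovPair n m} (h1 : Z.1.PosSemidef)
    (h2 : Z.2.PosSemidef) (D : CovPair n m) :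
    HasDerivAt (fun s : ℝ => S.rate0 (Z + s • D).1 - S.rateEveApprox k Z (Z + s • D))
      (S.marginDiff k Z D) 0 := by
  rw [marginDiff_apply]
  have hlin : HasDerivAt (fun s : ℝ => S.varphiLin k Z (Z + s • D))
      (tracePairing (S.gradT k Z) (S.gradR k Z) D) 0 := by
    have h := (hasDerivAt_linearMap_line (tracePairing (S.gradT k Z) (S.gradR k Z)) 0 D).const_add
      (S.varphi k Z)
    simpa [varphiLin_eq] using h
  exact (S.hasDerivAt_rate0 h1 D.1).sub (hlin.sub (S.hasDerivAt_phi k h2 D.2))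

theorem interference_eq_tracePairing (Z : CovPair n m) :
    S.interference Z = tracePairing (S.Gᴴ * S.G) ((S.G * S.V)ᴴ * (S.G * S.V)) Z := by
  have h1 := trace_mul_sandwich S.G 1 Z.1
  have h2 := trace_mul_sandwich (S.G * S.V) 1 Z.2
  rw [Matrix.one_mul, Matrix.mul_one] at h1 h2
  rw [interference, tracePairing_apply, ← h1, ← h2, Matrix.trace_add, Complex.add_re,
    Matrix.conjTranspose_mul]
  simp only [Matrix.mul_assoc]

theorem transmitPower_eq_tracePairing (Z : CovPair n m) :
    transmitPower Z = tracePairing 1 1 Z := by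
  simp [transmitPower, tracePairing_apply]

theorem convex_posSemidef_pairs :
    Convex ℝ {Z : CovPair n m | Z.1.PosSemidef ∧ Z.2.PosSemidef} := by
  rintro X ⟨hX1, hX2⟩ Y ⟨hY1, hY2⟩ a c ha hc -
  exact ⟨(hX1.smul ha).add (hY1.smul hc), (hX2.smul ha).add (hY2.smul hc)⟩

theorem convex_feasible : Convex ℝ S.feasible := by
  rintro X ⟨hX1, hX2, hX⟩ Y ⟨hY1, hY2, hY⟩ a c ha hc hac
  refine ⟨?_, ?_, convex_posSemidef_pairs hX hY ha hc hac⟩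
  · rw [interference_eq_tracePairing] at hX1 hY1 ⊢
    exact convex_halfSpace_le (tracePairing _ _).isLinear _ hX1 hY1 ha hc hac
  · rw [transmitPower_eq_tracePairing] at hX2 hY2 ⊢
    exact convex_halfSpace_le (tracePairing _ _).isLinear _ hX2 hY2 ha hc hac

/-! ### Fixed points of the iteration and stationarity for (P1). -/

/-- At a fixed point of the iteration, no feasible direction increases the margins of all active
eavesdroppers to first order. -/
theorem exists_marginDiff_nonpos [Finite κ] [Nonempty κ] {Z : CovPair n m} {t : ℝ}
    (hmem : (Z, t) ∈ S.approxFeasible Z)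
    (hmax : IsMaxOn S.approxObjective (S.approxFeasible Z) (Z, t))
    {Z' : CovPair n m} (hZ' : Z' ∈ S.feasible) :
    ∃ k, t - S.rateEve k Z ≤ 0 ∧ S.marginDiff k Z (Z' - Z) ≤ 0 := by
  have := Fintype.ofFinite κ
  by_contra! hneg
  obtain ⟨hfeas, hcon⟩ := hmem
  -- For small `s > 0` every surrogate margin would exceed the optimal value: active ones by their
  -- positive derivative, inactive ones by continuity.
  have hev : ∀ k, ∀ᶠ s : ℝ in 𝓝[>] 0, S.rate0 Z.1 - t <
      S.rate0 (Z + s • (Z' - Z)).1 - S.rateEveApprox k Z (Z + s • (Z' - Z)) := by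
    intro k
    have hd := S.hasDerivAt_approxMargin k hfeas.2.2.1 hfeas.2.2.2 (Z' - Z)
    rcases le_or_gt (t - S.rateEve k Z) 0 with hk | hk
    · have hpos := hneg k hk
      have hslope := (hasDerivAt_iff_tendsto_slope.1 hd).mono_left
        (nhdsWithin_mono (0 : ℝ) (fun s (hs : 0 < s) => hs.ne'))
      filter_upwards [hslope.eventually_const_lt hpos, self_mem_nhdsWithin] with s hs hs0
      rw [slope_def_field, sub_zero] at hs
      have := (div_pos_iff_of_pos_right (show (0 : ℝ) < s from hs0)).1 hs
      simp only [zero_smul, add_zero, rateEveApprox_self] at this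
      have hck := hcon k
      rw [rateEveApprox_self] at hck
      linarith
    · refine (hd.continuousAt.tendsto.mono_left nhdsWithin_le_nhds).eventually_const_lt ?_
      simp only [zero_smul, add_zero, rateEveApprox_self]
      linarith
  obtain ⟨s, hs, hs0, hs1⟩ := ((eventually_all.2 hev).and
    (Ioo_mem_nhdsGT (zero_lt_one' ℝ))).exists
  have hY : Z + s • (Z' - Z) ∈ S.feasible :=
    S.convex_feasible.add_smul_sub_mem hfeas hZ' ⟨hs0.le, hs1.le⟩
  -- Taking the largest surrogate rate as the new `t` gives a feasible point of the subproblem,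
  -- whose objective must not beat the optimum.
  obtain ⟨k, hk⟩ := Finite.exists_max fun k => S.rateEveApprox k Z (Z + s • (Z' - Z))
  have h := hmax (show (Z + s • (Z' - Z), S.rateEveApprox k Z (Z + s • (Z' - Z))) ∈
    S.approxFeasible Z from ⟨hY, hk⟩)
  exact absurd (hs k) (not_lt.2 h)

theorem isStationaryPoint_of_isMaxOn [Fintype κ] [Nonempty κ] {Z : CovPair n m} {t : ℝ}
    (hmem : (Z, t) ∈ S.approxFeasible Z)
    (hmax : IsMaxOn S.approxObjective (S.approxFeasible Z) (Z, t)) : S.IsStationaryPoint Z := by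
  obtain ⟨hfeas, hcon⟩ := hmem
  refine ⟨hfeas, fun Z' hZ' => ?_⟩
  obtain ⟨k, hk, hdk⟩ := S.exists_marginDiff_nonpos ⟨hfeas, hcon⟩ hmax hZ'
  have h0 := (S.hasDerivAt_rate0 hfeas.2.2.1 (Z' - Z).1).hasDerivWithinAt (s := Set.Ici 0)
  have hE : ∀ j, HasDerivWithinAt (fun s : ℝ => S.rateEve j (Z + s • (Z' - Z))) _ (Set.Ici 0) 0 :=
    fun j => ((S.hasDerivAt_varphi j hfeas.2.2.1 hfeas.2.2.2 (Z' - Z)).sub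
      (S.hasDerivAt_phi j hfeas.2.2.2 (Z' - Z).2)).hasDerivWithinAt
  obtain ⟨d, hd⟩ := HasDerivWithinAt.exists_finset_sup' hE Finset.univ Finset.univ_nonempty
  have hs := h0.sub hd
  refine ⟨_, ?_, hs⟩
  -- `C_s` lies below the margin of the active `k` and equals it at `Z`, so its right derivative is
  -- at most that of the margin.
  refine le_trans (HasDerivWithinAt.le_of_le_of_eq hs
    (S.hasDerivAt_margin k hfeas.2.2.1 hfeas.2.2.2 (Z' - Z)).hasDerivWithinAt
    (fun s => sub_le_sub_left (Finset.le_sup' (fun j => S.rateEve j (Z + s • (Z' - Z)))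
      (Finset.mem_univ k)) _) ?_) hdk
  simp only [Pi.sub_apply, zero_smul, add_zero]
  refine congrArg _ (le_antisymm (Finset.sup'_le _ _ fun j _ => ?_)
    (Finset.le_sup' (fun j => S.rateEve j Z) (Finset.mem_univ k)))
  have := hcon j
  rw [rateEveApprox_self] at this
  linarith

/-! ### Multipliers and the KKT conditions. -/

theorem isHermitian_gradRate0 {Q : Matrix (Fin n) (Fin n) ℂ} (hQ : Q.PosSemidef) :
    (S.gradRate0 Q).IsHermitian :=
  Matrix.isHermitian_conjTranspose_mul_mul _
    (posDef_one_add_mul_mul_conjTranspose S.H0 hQ).isHermitian.inv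

theorem isHermitian_gradPhi (k : κ) {W : Matrix (Fin m) (Fin m) ℂ} (hW : W.PosSemidef) :
    (S.gradPhi k W).IsHermitian :=
  Matrix.isHermitian_conjTranspose_mul_mul _
    (posDef_one_add_mul_mul_conjTranspose _ hW).isHermitian.inv

theorem isHermitian_gradT (k : κ) {Z : CovPair n m} (h1 : Z.1.PosSemidef) (h2 : Z.2.PosSemidef) :
    (S.gradT k Z).IsHermitian :=
  Matrix.isHermitian_conjTranspose_mul_mul _ (S.posDef_eveCov k h1 h2).isHermitian.inv

theorem isHermitian_gradR (k : κ) {Z : CovPair n m} (h1 : Z.1.PosSemidef) (h2 : Z.2.PosSemidef) :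
    (S.gradR k Z).IsHermitian :=
  Matrix.isHermitian_conjTranspose_mul_mul _ (S.posDef_eveCov k h1 h2).isHermitian.inv

/-- Multiplier rule: nonnegative multipliers for which `Z` maximizes the linearized Lagrangian
over all pairs of positive semidefinite matrices. -/
theorem exists_multipliers [Fintype κ] [Nonempty κ] (hinterf : 0 < S.interf)
    (hpower : 0 < S.power) {Z : CovPair n m} {t : ℝ} (hmem : (Z, t) ∈ S.approxFeasible Z)
    (hmax : IsMaxOn S.approxObjective (S.approxFeasible Z) (Z, t)) :
    ∃ (μ₁ μ₂ : ℝ) (lam : κ → ℝ), 0 ≤ μ₁ ∧ 0 ≤ μ₂ ∧ (∀ k, 0 ≤ lam k) ∧ ∑ k, lam k = 1 ∧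
      μ₁ * (S.interference Z - S.interf) = 0 ∧ μ₂ * (transmitPower Z - S.power) = 0 ∧
      (∀ k, lam k * (t - S.rateEve k Z) = 0) ∧
      ∀ Z' : CovPair n m, Z'.1.PosSemidef → Z'.2.PosSemidef →
        ∑ k, lam k * S.marginDiff k Z (Z' - Z) ≤
          μ₁ * (S.interference Z' - S.interf) + μ₂ * (transmitPower Z' - S.power) := by
  obtain ⟨hfeas, hcon⟩ := hmem
  simp only [rateEveApprox_self] at hcon
  obtain ⟨w, hw0, ⟨i, hi⟩, hw⟩ := exists_nonneg_weights_of_no_common_pos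
    (convex_posSemidef_pairs (n := n) (m := m))
    (Sum.elim (fun k : κ => S.marginDiff k Z)
      ![-tracePairing (S.Gᴴ * S.G) ((S.G * S.V)ᴴ * (S.G * S.V)), -tracePairing 1 1])
    -- With these constants the affine functions are `t - C_k(Z)` plus the margin differential at
    -- `Z' - Z`, and the two power slacks. The term `t - C_k(Z)` keeps inactive eavesdroppers from
    -- obstructing and later yields slackness.
    (Sum.elim (fun k => t - S.rateEve k Z - S.marginDiff k Z Z) ![S.interf, S.power]) (by
      rintro Z' hZ'
      by_contra! h
      have h1 := h (Sum.inr 0)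
      have h2 := h (Sum.inr 1)
      simp only [Sum.elim_inr, Matrix.cons_val_zero, Matrix.cons_val_one, LinearMap.neg_apply,
        ← interference_eq_tracePairing, ← transmitPower_eq_tracePairing] at h1 h2
      obtain ⟨k, hk, hdk⟩ := S.exists_marginDiff_nonpos ⟨hfeas, fun k => by
        rw [rateEveApprox_self]; exact hcon k⟩ hmax
        (show Z' ∈ S.feasible from ⟨by linarith, by linarith, hZ'⟩)
      have h3 := h (Sum.inl k)
      simp only [Sum.elim_inl] at h3
      rw [map_sub] at hdk
      linarith) ⟨0, Matrix.PosSemidef.zero, Matrix.PosSemidef.zero⟩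
  have key : ∀ Z' : CovPair n m, Z'.1.PosSemidef → Z'.2.PosSemidef →
      ∑ k, w (Sum.inl k) * (S.marginDiff k Z (Z' - Z) + (t - S.rateEve k Z)) ≤
        w (Sum.inr 0) * (S.interference Z' - S.interf)
          + w (Sum.inr 1) * (transmitPower Z' - S.power) := by
    intro Z' h1 h2
    have h := hw Z' ⟨h1, h2⟩
    simp only [Fintype.sum_sum_type, Fin.sum_univ_two, Sum.elim_inl, Sum.elim_inr,
      Matrix.cons_val_zero, Matrix.cons_val_one, LinearMap.neg_apply,
      ← interference_eq_tracePairing, ← transmitPower_eq_tracePairing] at h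
    have he : ∑ k, w (Sum.inl k) * (S.marginDiff k Z (Z' - Z) + (t - S.rateEve k Z)) =
        ∑ k, w (Sum.inl k) * (S.marginDiff k Z Z' + (t - S.rateEve k Z - S.marginDiff k Z Z)) :=
      Finset.sum_congr rfl fun k _ => by rw [map_sub]; ring
    rw [he]
    linarith
  have hs0 : ∀ k, 0 ≤ w (Sum.inl k) * (t - S.rateEve k Z) :=
    fun k => mul_nonneg (hw0 _) (sub_nonneg.2 (hcon k))
  have hi0 : w (Sum.inr 0) * (S.interference Z - S.interf) ≤ 0 :=
    mul_nonpos_of_nonneg_of_nonpos (hw0 _) (sub_nonpos.2 hfeas.1)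
  have hp0 : w (Sum.inr 1) * (transmitPower Z - S.power) ≤ 0 :=
    mul_nonpos_of_nonneg_of_nonpos (hw0 _) (sub_nonpos.2 hfeas.2.1)
  -- At `Z' = Z` a sum of nonnegative terms is bounded by a sum of nonpositive ones, so every term
  -- vanishes: this is complementary slackness.
  have hZ := key Z hfeas.2.2.1 hfeas.2.2.2
  simp only [sub_self, map_zero, zero_add] at hZ
  have hsum0 := Finset.sum_nonneg fun k (_ : k ∈ Finset.univ) => hs0 k
  have hslack : ∀ k, w (Sum.inl k) * (t - S.rateEve k Z) = 0 := fun k =>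
    (Finset.sum_eq_zero_iff_of_nonneg fun k _ => hs0 k).1 (by linarith) k (Finset.mem_univ k)
  have hkey : ∀ Z' : CovPair n m, Z'.1.PosSemidef → Z'.2.PosSemidef →
      ∑ k, w (Sum.inl k) * S.marginDiff k Z (Z' - Z) ≤
        w (Sum.inr 0) * (S.interference Z' - S.interf)
          + w (Sum.inr 1) * (transmitPower Z' - S.power) := by
    intro Z' h1 h2
    simpa only [mul_add, hslack, add_zero] using key Z' h1 h2
  -- Slater's argument: without weight on the eavesdroppers, evaluation at 0 forces both power
  -- weights to vanish, hence all weights.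
  have hpos : 0 < ∑ k, w (Sum.inl k) := by
    refine (Finset.sum_nonneg fun k _ => hw0 _).lt_of_ne fun h0 => hi ?_
    have hl : ∀ k, w (Sum.inl k) = 0 := fun k =>
      (Finset.sum_eq_zero_iff_of_nonneg fun k _ => hw0 _).1 h0.symm k (Finset.mem_univ k)
    have h := hkey 0 Matrix.PosSemidef.zero Matrix.PosSemidef.zero
    simp only [hl, zero_mul, Finset.sum_const_zero, interference_eq_tracePairing,
      transmitPower_eq_tracePairing, map_zero, zero_sub, mul_neg] at h
    have h1 := mul_nonneg (hw0 (Sum.inr 0)) hinterf.le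
    have h2 := mul_nonneg (hw0 (Sum.inr 1)) hpower.le
    rcases i with k | i
    · exact hl k
    · fin_cases i
      · exact (mul_eq_zero.1 (show w (Sum.inr 0) * S.interf = 0 by linarith)).resolve_right
          hinterf.ne'
      · exact (mul_eq_zero.1 (show w (Sum.inr 1) * S.power = 0 by linarith)).resolve_right
          hpower.ne'
  set c := (∑ k, w (Sum.inl k))⁻¹ with hc
  have hc0 : 0 ≤ c := inv_nonneg.2 hpos.le
  refine ⟨c * w (Sum.inr 0), c * w (Sum.inr 1), fun k => c * w (Sum.inl k),
    mul_nonneg hc0 (hw0 _), mul_nonneg hc0 (hw0 _), fun k => mul_nonneg hc0 (hw0 _), ?_, ?_, ?_,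
    fun k => ?_, fun Z' h1 h2 => ?_⟩
  · rw [← Finset.mul_sum, hc, inv_mul_cancel₀ hpos.ne']
  · rw [mul_assoc, show w (Sum.inr 0) * (S.interference Z - S.interf) = 0 by linarith, mul_zero]
  · rw [mul_assoc, show w (Sum.inr 1) * (transmitPower Z - S.power) = 0 by linarith, mul_zero]
  · rw [mul_assoc, hslack, mul_zero]
  · simp only [mul_assoc, ← Finset.mul_sum, ← mul_add]
    exact mul_le_mul_of_nonneg_left (hkey Z' h1 h2) hc0

/-- The differential of the Lagrangian in the direction `D`. -/
theorem hasDerivAt_lagrangian [Fintype κ] (μ₁ μ₂ : ℝ) (lam : κ → ℝ)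
    (M : Matrix (Fin n) (Fin n) ℂ) (N : Matrix (Fin m) (Fin m) ℂ) {Z : CovPair n m}
    (h1 : Z.1.PosSemidef) (h2 : Z.2.PosSemidef) (t₂ : ℝ) (D : CovPair n m) :
    HasDerivAt (fun s : ℝ => S.lagrangian μ₁ μ₂ lam M N (Z + s • D).1 (Z + s • D).2 t₂)
      (μ₁ * S.interference D + μ₂ * transmitPower D - tracePairing M N D
        - ∑ k, lam k * S.marginDiff k Z D) 0 := by
  have hI := ((hasDerivAt_linearMap_line (tracePairing (S.Gᴴ * S.G) ((S.G * S.V)ᴴ * (S.G * S.V)))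
    Z D).sub_const S.interf).const_mul μ₁
  have hP := ((hasDerivAt_linearMap_line (tracePairing 1 1) Z D).sub_const S.power).const_mul μ₂
  have hMN := hasDerivAt_linearMap_line (tracePairing M N) Z D
  have hE := HasDerivAt.fun_sum (u := Finset.univ) fun k _ =>
    ((S.hasDerivAt_margin k h1 h2 D).const_sub t₂).const_mul (lam k)
  simp only [← interference_eq_tracePairing, ← transmitPower_eq_tracePairing] at hI hP
  refine (((((hI.const_add (-t₂)).add hP).sub hMN).add hE).congr_deriv ?_).congr_of_eventuallyEq
    (.of_forall fun s => ?_)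
  · simp only [mul_neg, Finset.sum_neg_distrib]
    ring
  · simp only [lagrangian, Pi.add_apply, Pi.sub_apply, tracePairing_apply, Complex.add_re]
    refine congrArg _ (Finset.sum_congr rfl fun k _ => ?_)
    ring

theorem isKKTPoint_of_isMaxOn [Fintype κ] [Nonempty κ] (hinterf : 0 < S.interf)
    (hpower : 0 < S.power) {Z : CovPair n m} {t : ℝ} (hmem : (Z, t) ∈ S.approxFeasible Z)
    (hmax : IsMaxOn S.approxObjective (S.approxFeasible Z) (Z, t)) :
    S.IsKKTPoint Z (S.rate0 Z.1 - t) := by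
  obtain ⟨μ₁, μ₂, lam, hμ₁, hμ₂, hlam, hsum, hs₁, hs₂, hs₃, hkey⟩ :=
    S.exists_multipliers hinterf hpower hmem hmax
  obtain ⟨hfeas, hcon⟩ := hmem
  simp only [rateEveApprox_self] at hcon
  have h1 := hfeas.2.2.1
  have h2 := hfeas.2.2.2
  -- `M` and `N` are what the stationarity equations in `Q` and `W` dictate; the multiplier rule
  -- then says that `Z` minimizes their pairing over the cone.
  set M : Matrix (Fin n) (Fin n) ℂ := μ₁ • (S.Gᴴ * S.G) + μ₂ • (1 : Matrix (Fin n) (Fin n) ℂ)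
    - ∑ k, lam k • (S.gradRate0 Z.1 - S.gradT k Z) with hM
  set N : Matrix (Fin m) (Fin m) ℂ := μ₁ • ((S.G * S.V)ᴴ * (S.G * S.V))
    + μ₂ • (1 : Matrix (Fin m) (Fin m) ℂ)
    - ∑ k, lam k • (S.gradPhi k Z.2 - S.gradR k Z) with hN
  have hMN : ∀ D, tracePairing M N D = μ₁ * S.interference D + μ₂ * transmitPower D
      - ∑ k, lam k * S.marginDiff k Z D := by
    intro D
    simp only [interference_eq_tracePairing, transmitPower_eq_tracePairing, marginDiff,
      tracePairing_apply, hM, hN, Matrix.sub_mul, Matrix.add_mul, Matrix.sum_mul, Matrix.smul_mul,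
      Matrix.trace_sub, Matrix.trace_add, Matrix.trace_sum, Matrix.trace_smul, Complex.sub_re,
      Complex.add_re, Complex.re_sum, Complex.real_smul, Complex.re_ofReal_mul, mul_add, mul_sub,
      Finset.sum_add_distrib, Finset.sum_sub_distrib]
    ring
  have hge : ∀ Z' : CovPair n m, Z'.1.PosSemidef → Z'.2.PosSemidef →
      tracePairing M N Z ≤ tracePairing M N Z' := by
    intro Z' hZ1 hZ2
    have h := hkey Z' hZ1 hZ2
    simp only [map_sub, mul_sub, Finset.sum_sub_distrib] at h hs₁ hs₂
    rw [hMN, hMN]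
    linarith
  -- A linear functional minimized over a cone at `Z` vanishes there: compare with `0` and `2 • Z`.
  have hzero : tracePairing M N Z = 0 := by
    have ha := hge 0 Matrix.PosSemidef.zero Matrix.PosSemidef.zero
    have hb := hge (2 • Z) (h1.add h1 |> fun h => by simpa [two_smul] using h)
      (h2.add h2 |> fun h => by simpa [two_smul] using h)
    rw [map_zero] at ha
    rw [map_nsmul, two_nsmul] at hb
    linarith
  have hMh : M.IsHermitian := by
    simp only [hM, Matrix.IsHermitian, Matrix.conjTranspose_sub, Matrix.conjTranspose_add,
      Matrix.conjTranspose_smul, Matrix.conjTranspose_sum, Matrix.conjTranspose_one,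
      Matrix.conjTranspose_mul, Matrix.conjTranspose_conjTranspose, star_trivial,
      (S.isHermitian_gradRate0 h1).eq, (S.isHermitian_gradT _ h1 h2).eq]
  have hNh : N.IsHermitian := by
    simp only [hN, Matrix.IsHermitian, Matrix.conjTranspose_sub, Matrix.conjTranspose_add,
      Matrix.conjTranspose_smul, Matrix.conjTranspose_sum, Matrix.conjTranspose_one,
      Matrix.conjTranspose_mul, Matrix.conjTranspose_conjTranspose, star_trivial,
      (S.isHermitian_gradPhi _ h2).eq, (S.isHermitian_gradR _ h1 h2).eq]
  have hMQ : ∀ Q : Matrix (Fin n) (Fin n) ℂ, Q.PosSemidef → 0 ≤ (M * Q).trace.re := by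
    intro Q hQ
    have := hge (Q, 0) hQ Matrix.PosSemidef.zero
    rw [hzero] at this
    simpa [tracePairing_apply] using this
  have hNW : ∀ W : Matrix (Fin m) (Fin m) ℂ, W.PosSemidef → 0 ≤ (N * W).trace.re := by
    intro W hW
    have := hge (0, W) Matrix.PosSemidef.zero hW
    rw [hzero] at this
    simpa [tracePairing_apply] using this
  have hMp := hMh.posSemidef_of_trace_mul_re_nonneg hMQ
  have hNp := hNh.posSemidef_of_trace_mul_re_nonneg hNW
  have hM0 := hMQ _ h1
  have hN0 := hNW _ h2
  have hD : ∀ D, HasDerivAt (fun s : ℝ => S.lagrangian μ₁ μ₂ lam M N (Z + s • D).1 (Z + s • D).2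
      (S.rate0 Z.1 - t)) 0 0 := fun D =>
    (S.hasDerivAt_lagrangian μ₁ μ₂ lam M N h1 h2 _ D).congr_deriv (by rw [hMN]; ring)
  rw [tracePairing_apply] at hzero
  refine ⟨μ₁, μ₂, lam, M, N, ⟨Matrix.isHermitian_zero, fun D _ => ?_⟩,
    ⟨Matrix.isHermitian_zero, fun D _ => ?_⟩, ?_, hs₁, hs₂,
    hMp.mul_eq_zero_of_trace_re_eq_zero h1 (by linarith),
    hNp.mul_eq_zero_of_trace_re_eq_zero h2 (by linarith), fun k => ?_, hμ₁, hμ₂, hlam, hMp, hNp,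
    hfeas, fun k => ?_⟩
  · simpa using hD (D, 0)
  · simpa using hD (0, D)
  · have hE := HasDerivAt.fun_sum (u := Finset.univ) fun k _ =>
      ((((hasDerivAt_id (S.rate0 Z.1 - t)).add_const (S.rateEve k Z)).sub_const
        (S.rate0 Z.1)).const_mul (lam k))
    refine ((((((hasDerivAt_id (S.rate0 Z.1 - t)).neg.add_const
      (μ₁ * (S.interference Z - S.interf))).add_const
      (μ₂ * (transmitPower Z - S.power))).sub_const
      ((M * Z.1).trace + (N * Z.2).trace).re).add hE).congr_deriv ?_)
    -- The derivative in `t₂` is `-1 + ∑ k, lam k`, which is why the multipliers were normalized.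
    simp [hsum]
  · linear_combination -hs₃ k
  · linarith [hcon k]

end WiretapChannel

theorem proposition3 {n m b p : ℕ} {κ : Type*} [Fintype κ] [Nonempty κ] {e : κ → ℕ}
    (S : WiretapChannel n m b p e) (hinterf : 0 < S.interf) (hpower : 0 < S.power)
    (Z : ℕ → CovPair n m) (t : ℕ → ℝ) (hiter : S.IsSCAIteration Z t)
    (v : ℕ) (hv : 1 ≤ v) (Zc : CovPair n m) (hZc : Zc = Z v) (hconv : Z v = Z (v - 1)) :
    S.IsKKTPoint Zc (S.rate0 Zc.1 - t v) ∧ S.IsStationaryPoint Zc := by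
  -- The subproblem producing `Z v` is expanded at `Z (v - 1)`, which equals `Z v`.
  obtain ⟨hmem, hmax⟩ := hiter (v - 1)
  rw [Nat.sub_add_cancel hv, ← hconv, ← hZc] at hmem hmax
  exact ⟨S.isKKTPoint_of_isMaxOn hinterf hpower hmem hmax, S.isStationaryPoint_of_isMaxOn hmem hmax⟩
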